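/- Let $X$ be a metrizable compact space. Let $P(X)$ be the space of all Borel probability measures on $X$ with the weak topology (the coarsest one making $\mu\mapsto\int f\,d\mu$ continuous for each continuous $f:X\to\mathbb R$); it is again a metrizable compact space. For $A\subseteq X$ let $$\hat P(A)=\{\mu\in P(X)\mid \mu_*(A)=1\},\qquad \mu_*(A)=\sup\{\mu(B)\mid B\subseteq A,\ B \text{ a Borel subset of } X\},$$ which is the space of Radon probability measures on $A$ viewed as a subset of $P(X)$. For a metrizable compact space $Y$ let $\mathcal P(Y)$ (the projective subsets of $Y$) be the smallest family of subsets of $Y$ that contains all Borel sets, contains $f(A)$ for every $A\in\mathcal P(Y)$ and every continuous map $f:A\to Y$, and contains $Y\setminus A$ for every $A\in\mathcal P(Y)$. Let $\mathcal P_0(Y)$ be the family of Borel subsets of $Y$ and, for $n\ge 0$, let $$\mathcal P_{2n+1}(Y)=\{f(A)\mid A\in\mathcal P_{2n}(Y),\ f:A\to Y \text{ continuous}\},\qquad \mathcal P_{2n+2}(Y)=\{Y\setminus A\mid A\in\mathcal P_{2n+1}(Y)\}.$$ Theorem. The functor $\hat P$ preserves projective subsets of metrizable compacta: if $A\in\mathcal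 P(X)$, then $\hat P(A)\in\mathcal P(P(X))$. Furthermore, for every $n\ge 0$, if $A\in\mathcal P_{2n}(X)$, then $\hat P(A)\in\mathcal P_{2n+1}(P(X))$. -/

import Mathlib

open MeasureTheory

/-- The classes `𝒫ₙ(X)` of projective subsets of a space `X`: `𝒫₀(X)` consists of the Borel sets,
`𝒫₂ₖ₊₁(X)` of the images `f(A) ⊆ X` of sets `A ∈ 𝒫₂ₖ(X)` under continuous maps `f : A → X`, and
`𝒫₂ₖ₊₂(X)` of the complements of the members of `𝒫₂ₖ₊₁(X)`. -/
def projectiveClass (X : Type*) [TopologicalSpace X] : ℕ → Set (Set X)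
  | 0 => {B | MeasurableSet[borel X] B}
  | n + 1 =>
    if Even n then
      {B | ∃ A ∈ projectiveClass X n, ∃ f : A → X, Continuous f ∧ Set.range f = B}
    else
      {B | Bᶜ ∈ projectiveClass X n}

/-- The projective subsets of `X`: the smallest family of subsets of `X` that contains the Borel
sets and is closed under images by continuous maps `f : A → X` defined on members `A` of the family
and under complements. -/
inductive IsProjective {X : Type*} [TopologicalSpace X] : Set X → Prop
  | borel (A : Set X) (hA : MeasurableSet[borel X] A) : IsProjective A
  | image (A : Set X) (hA : IsProjective A) (f : A → X) (hf : Continuous f) :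
      IsProjective (Set.range f)
  | compl (A : Set X) (hA : IsProjective A) : IsProjective Aᶜ

/-- The inner measure `μ_*(A) = sup {μ(B) | B ⊆ A, B Borel}`. -/
noncomputable def innerMeasure {X : Type*} [MeasurableSpace X] (μ : Measure X) (A : Set X) :
    ENNReal :=
  ⨆ (B : Set X) (_ : MeasurableSet B) (_ : B ⊆ A), μ B

/-- The space of Radon probability measures on `A`, for `A` a subset of a metrizable compactum `X`,
viewed as the subset `{μ ∈ P(X) | μ_*(A) = 1}` of the space `P(X)` of all Borel probability
measures on `X` (with the weak topology). -/
def radonProb {X : Type*} [MeasurableSpace X] (A : Set X) : Set (ProbabilityMeasure X) :=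
  {μ | innerMeasure (μ : Measure X) A = 1}

open Set Topology Filter TopologicalSpace

universe u v

/-! By inner regularity, `μ_*(A) = 1` iff for each `k` some closed `K ⊆ A` has `μ K > u k`, where `u
k` increases to 1. Closed sets are coded by points `c` of the Baire space. If `Aᶜ` is `Σ¹ₙ` with `n
≥ 1`, then `K_c ⊆ A` is a co-`Σ¹ₙ` condition on `c`, and `μ K_c > u k` is Borel in `(μ, c)`;
projecting out `c` and intersecting over `k` gives a `Σ¹ₙ₊₁` set (`IsSigma.innerMeasure_eq_one`).
Translating between `Σ¹ₙ` and `𝒫ₙ` on Polish spaces finishes the proof. -/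

/-- The boldface classes `Σ¹ₙ` of subsets of a measurable space: `Σ¹₀` consists of the measurable
sets and `Σ¹ₙ₊₁` of the projections along the Baire space of complements of `Σ¹ₙ` sets. -/
def IsSigma : ℕ → ∀ {Y : Type u} [MeasurableSpace Y], Set Y → Prop
  | 0, _, _, A => MeasurableSet A
  | n + 1, Y, _, A => ∃ B : Set (Y × (ℕ → ℕ)), IsSigma n Bᶜ ∧ Prod.fst '' B = A

/-! ### Closure properties of the classes `Σ¹ₙ`. -/

namespace IsSigma

variable {Y : Type u} [MeasurableSpace Y] {Z : Type v} [MeasurableSpace Z]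

theorem preimage {n : ℕ} {A : Set Z} (hA : IsSigma n A) {f : Y → Z} (hf : Measurable f) :
    IsSigma n (f ⁻¹' A) := by
  induction n generalizing Y Z with
  | zero => exact hf hA
  | succ n ih =>
    obtain ⟨B, hB, rfl⟩ := hA
    refine ⟨Prod.map f id ⁻¹' B, ih hB (hf.prodMap measurable_id), ?_⟩
    ext y
    simp

theorem succ_of_compl {n : ℕ} {A : Set Y} (hA : IsSigma n Aᶜ) : IsSigma (n + 1) A := by
  refine ⟨Prod.fst ⁻¹' A, hA.preimage measurable_fst, ?_⟩
  ext y
  simp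

theorem succ {n : ℕ} {A : Set Y} (hA : IsSigma n A) : IsSigma (n + 1) A := by
  induction n generalizing Y with
  | zero => exact succ_of_compl (MeasurableSet.compl hA)
  | succ n ih =>
    obtain ⟨B, hB, rfl⟩ := hA
    exact ⟨B, ih hB, rfl⟩

theorem of_measurableSet (n : ℕ) {A : Set Y} (hA : MeasurableSet A) : IsSigma n A := by
  induction n with
  | zero => exact hA
  | succ n ih => exact ih.succ

/-- Complements swap the two claims, so they are proved together. For intersections, `Nat.pair`
packs countably many witnesses into one. -/
theorem iUnion_and_iInter (n : ℕ) {A : ℕ → Set Y} (hA : ∀ i, IsSigma n (A i)) :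
    IsSigma n (⋃ i, A i) ∧ IsSigma n (⋂ i, A i) := by
  induction n generalizing Y with
  | zero => exact ⟨MeasurableSet.iUnion hA, MeasurableSet.iInter hA⟩
  | succ n ih =>
    choose B hB hBA using hA
    constructor
    · refine ⟨⋃ i, B i, ?_, by rw [image_iUnion, iUnion_congr hBA]⟩
      rw [compl_iUnion]
      exact (ih hB).2
    · let s (i : ℕ) : Y × (ℕ → ℕ) → Y × (ℕ → ℕ) := fun p ↦ (p.1, fun j ↦ p.2 (Nat.pair i j))
      have hs (i : ℕ) : Measurable (s i) := by fun_prop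
      refine ⟨⋂ i, s i ⁻¹' B i, ?_, ?_⟩
      · rw [compl_iInter]
        exact (ih fun i ↦ (hB i).preimage (hs i)).1
      · ext y
        simp only [← hBA, mem_image, mem_iInter, mem_preimage, Prod.exists, exists_and_right,
          exists_eq_right, s]
        constructor
        · rintro ⟨c, hc⟩ i
          exact ⟨_, hc i⟩
        · intro h
          choose d hd using h
          exact ⟨fun k ↦ d k.unpair.1 k.unpair.2, fun i ↦ by simpa using hd i⟩

theorem iInter {n : ℕ} {A : ℕ → Set Y} (hA : ∀ i, IsSigma n (A i)) : IsSigma n (⋂ i, A i) :=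
  (iUnion_and_iInter n hA).2

theorem union {n : ℕ} {A B : Set Y} (hA : IsSigma n A) (hB : IsSigma n B) :
    IsSigma n (A ∪ B) := by
  have h := (iUnion_and_iInter n (A := fun i : ℕ ↦ if i = 0 then A else B)
    fun i ↦ by split_ifs <;> assumption).1
  convert h using 1
  ext y
  simp only [mem_union, mem_iUnion]
  exact ⟨fun h ↦ h.elim (fun h ↦ ⟨0, by simpa⟩) fun h ↦ ⟨1, by simpa⟩,
    fun ⟨i, hi⟩ ↦ by split_ifs at hi <;> simp [hi]⟩

theorem inter {n : ℕ} {A B : Set Y} (hA : IsSigma n A) (hB : IsSigma n B) :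
    IsSigma n (A ∩ B) := by
  have h := iInter (A := fun i : ℕ ↦ if i = 0 then A else B)
    fun i ↦ by split_ifs <;> assumption
  convert h using 1
  ext y
  simp only [mem_inter_iff, mem_iInter]
  refine ⟨fun h i ↦ by split_ifs <;> simp [h], fun h ↦ ⟨by simpa using h 0, by simpa using h 1⟩⟩

theorem image_fst [StandardBorelSpace Z] {n : ℕ} {A : Set (Y × Z)} (hA : IsSigma (n + 1) A) :
    IsSigma (n + 1) (Prod.fst '' A) := by
  rcases isEmpty_or_nonempty Z with hZ | hZ
  · rw [eq_empty_of_isEmpty A, image_empty]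
    exact of_measurableSet _ .empty
  obtain ⟨B, hB, rfl⟩ := hA
  let := upgradeStandardBorel Z
  obtain ⟨g, hg, hgs⟩ := PolishSpace.exists_nat_nat_continuous_surjective Z
  let s : Y × (ℕ → ℕ) → (Y × Z) × (ℕ → ℕ) :=
    fun p ↦ ((p.1, g fun j ↦ p.2 (2 * j)), fun j ↦ p.2 (2 * j + 1))
  have hg' : Measurable g := hg.measurable
  have hs : Measurable s := by fun_prop
  refine ⟨s ⁻¹' B, hB.preimage hs, ?_⟩
  ext y
  simp only [mem_image, mem_preimage, Prod.exists, exists_and_right, exists_eq_right, s]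
  constructor
  · rintro ⟨c, hc⟩
    exact ⟨_, _, hc⟩
  · rintro ⟨z, d, h⟩
    obtain ⟨c, rfl⟩ := hgs z
    refine ⟨fun k ↦ if k % 2 = 0 then c (k / 2) else d (k / 2), ?_⟩
    have h1 (j : ℕ) : (2 * j + 1) / 2 = j := by omega
    have h2 (j : ℕ) : (2 * j + 1) % 2 = 1 := by omega
    simpa [h1, h2] using h

theorem image [StandardBorelSpace Y] [StandardBorelSpace Z] {n : ℕ} {A : Set Y}
    (hA : IsSigma (n + 1) A) {f : Y → Z} (hf : Measurable f) : IsSigma (n + 1) (f '' A) := by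
  have hG : MeasurableSet {p : Z × Y | p.1 = f p.2} :=
    measurableSet_eq_fun measurable_fst (hf.comp measurable_snd)
  convert ((of_measurableSet (n + 1) hG).inter (hA.preimage measurable_snd)).image_fst using 1
  ext z
  simp only [mem_image, mem_inter_iff, mem_ofPred_eq, mem_preimage, Prod.exists, exists_and_right,
    exists_eq_right]
  exact ⟨fun ⟨y, hy, h⟩ ↦ ⟨y, h.symm, hy⟩, fun ⟨y, h, hy⟩ ↦ ⟨y, hy, h.symm⟩⟩

/-- A measurable map from any subset into a nonempty standard Borel space extends measurably to the
whole space. -/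
theorem range [StandardBorelSpace Y] [StandardBorelSpace Z] {n : ℕ} {A : Set Y}
    (hA : IsSigma (n + 1) A) {f : A → Z} (hf : Measurable f) : IsSigma (n + 1) (range f) := by
  rcases isEmpty_or_nonempty Z with hZ | hZ
  · rw [eq_empty_of_isEmpty (Set.range f)]
    exact of_measurableSet _ .empty
  obtain ⟨h, hh, rfl⟩ := hf.exists_eq_measurable_comp
  rw [range_comp, Subtype.range_coe]
  exact hA.image hh

end IsSigma

/-! ### Comparison of `Σ¹ₙ` with the projective classes. -/

section projectiveClass

variable {Y : Type u} [TopologicalSpace Y]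

theorem mem_projectiveClass_odd {n : ℕ} {A : Set Y} : A ∈ projectiveClass Y (2 * n + 1) ↔
    ∃ B ∈ projectiveClass Y (2 * n), ∃ f : B → Y, Continuous f ∧ range f = A := by
  rw [projectiveClass, if_pos (even_two_mul n)]
  rfl

theorem mem_projectiveClass_even {n : ℕ} {A : Set Y} :
    A ∈ projectiveClass Y (2 * (n + 1)) ↔ Aᶜ ∈ projectiveClass Y (2 * n + 1) := by
  rw [show 2 * (n + 1) = (2 * n + 1) + 1 by ring, projectiveClass,
    if_neg (Nat.not_even_two_mul_add_one n)]
  rfl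

theorem IsProjective.of_mem_projectiveClass {n : ℕ} {A : Set Y} (hA : A ∈ projectiveClass Y n) :
    IsProjective A := by
  induction n generalizing A with
  | zero => exact .borel A hA
  | succ n ih =>
    rw [projectiveClass] at hA
    split_ifs at hA
    · obtain ⟨B, hB, f, hf, rfl⟩ := hA
      exact .image B (ih hB) f hf
    · exact compl_compl A ▸ .compl _ (ih hA)

theorem mem_projectiveClass_of_forall (h : ∀ A : Set Y, MeasurableSet[borel Y] A) (n : ℕ)
    (A : Set Y) : A ∈ projectiveClass Y n := by
  induction n generalizing A with
  | zero => exact h A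
  | succ n ih =>
    rw [projectiveClass]
    split_ifs
    · exact ⟨A, ih A, Subtype.val, continuous_subtype_val, Subtype.range_coe⟩
    · exact ih Aᶜ

variable [PolishSpace Y]

/-- Each sequence goes to the indicator of its graph, placing the Baire space inside the Cantor
space. -/
theorem isEmbedding_decide_eq :
    IsEmbedding fun (c : ℕ → ℕ) (k : ℕ) ↦ decide (c k.unpair.1 = k.unpair.2) := by
  refine ⟨isInducing_iff_nhds.2 fun c ↦ le_antisymm ?_ ?_, fun c d h ↦ funext fun i ↦ ?_⟩
  · refine Tendsto.le_comap (Continuous.tendsto ?_ c)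
    have h (m : ℕ) : Continuous fun j : ℕ ↦ decide (j = m) := continuous_of_discreteTopology
    exact continuous_pi fun k ↦ (h k.unpair.2).comp (continuous_apply k.unpair.1)
  · rw [nhds_pi (a := c)]
    refine le_pi.2 fun i ↦ ?_
    rw [nhds_discrete ℕ, tendsto_pure]
    have ho : IsOpen {x : ℕ → Bool | x (Nat.pair i (c i)) = true} :=
      (isOpen_discrete ({true} : Set Bool)).preimage
        (continuous_apply (A := fun _ ↦ Bool) (Nat.pair i (c i)))
    have h := ho.mem_nhds (x := fun k ↦ decide (c k.unpair.1 = k.unpair.2)) (by simp)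
    filter_upwards [tendsto_comap.eventually h] with d hd
    simpa using hd
  · simpa using congrFun h (Nat.pair i (d i))

theorem exists_isEmbedding_nat_nat (hY : ¬Countable Y) : ∃ e : (ℕ → ℕ) → Y, IsEmbedding e := by
  obtain ⟨f, -, hf, hfi⟩ := isClosed_univ.exists_nat_bool_injection_of_not_countable
    (α := Y) (by rwa [countable_univ_iff])
  exact ⟨_, (hf.isClosedEmbedding hfi).isEmbedding.comp isEmbedding_decide_eq⟩

variable [MeasurableSpace Y] [BorelSpace Y]

theorem isSigma_compl_of_mem_projectiveClass {n : ℕ} {A : Set Y}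
    (hA : A ∈ projectiveClass Y (2 * n)) : IsSigma n Aᶜ := by
  induction n generalizing A with
  | zero =>
    refine MeasurableSet.compl ?_
    rw [BorelSpace.measurable_eq (α := Y)]
    exact hA
  | succ n ih =>
    rw [mem_projectiveClass_even, mem_projectiveClass_odd] at hA
    obtain ⟨B, hB, f, hf, hfA⟩ := hA
    rw [← hfA]
    exact (ih hB).succ_of_compl.range hf.measurable

/-- Tracking the complement as well makes the induction pass through complements. -/
theorem IsProjective.exists_isSigma {A : Set Y} (hA : IsProjective A) :
    ∃ n, IsSigma n A ∧ IsSigma n Aᶜ := by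
  induction hA with
  | borel A hA =>
    rw [← BorelSpace.measurable_eq] at hA
    exact ⟨0, hA, hA.compl⟩
  | image A _ f hf ih =>
    obtain ⟨n, h, -⟩ := ih
    have h' := h.succ.range hf.measurable
    exact ⟨n + 2, h'.succ, .succ_of_compl (by rwa [compl_compl])⟩
  | compl A _ ih =>
    obtain ⟨n, h, h'⟩ := ih
    exact ⟨n, h', by rwa [compl_compl]⟩

/-- `𝒫ₙ` only allows maps defined on subsets of `Y`, so the set in `Y × (ℕ → ℕ)` is pulled back to
the Baire space along `g` and copied into `Y` by an embedding `e`. -/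
theorem IsSigma.mem_projectiveClass {n : ℕ} {A : Set Y} (hA : IsSigma (n + 1) A) :
    A ∈ projectiveClass Y (2 * n + 1) := by
  -- A countable `Y` may contain no copy of the Baire space, but all its subsets are Borel.
  by_cases hY : Countable Y
  · refine mem_projectiveClass_of_forall (fun A ↦ ?_) _ A
    rw [← BorelSpace.measurable_eq]
    exact A.to_countable.measurableSet
  obtain ⟨e, he⟩ := exists_isEmbedding_nat_nat hY
  have : Nonempty Y := ⟨e 0⟩
  have hem : MeasurableEmbedding e := he.continuous.measurableEmbedding he.injective
  obtain ⟨r, hr, hre⟩ := hem.exists_measurable_extend measurable_id fun _ ↦ inferInstance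
  have hre' (c : ℕ → ℕ) : r (e c) = c := congrFun hre c
  obtain ⟨g, hg, hgs⟩ := PolishSpace.exists_nat_nat_continuous_surjective (Y × (ℕ → ℕ))
  have step {n : ℕ} (hn : ∀ B : Set Y, IsSigma n Bᶜ → B ∈ projectiveClass Y (2 * n))
      {A : Set Y} (hA : IsSigma (n + 1) A) : A ∈ projectiveClass Y (2 * n + 1) := by
    obtain ⟨B, hB, rfl⟩ := hA
    have himage : e '' (g ⁻¹' B) = Set.range e ∩ r ⁻¹' (g ⁻¹' B) := by
      ext y
      constructor
      · rintro ⟨c, hc, rfl⟩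
        exact ⟨⟨c, rfl⟩, by simpa [hre'] using hc⟩
      · rintro ⟨⟨c, rfl⟩, hc⟩
        exact ⟨c, by simpa [hre'] using hc, rfl⟩
    refine mem_projectiveClass_odd.2 ⟨e '' (g ⁻¹' B), hn _ ?_,
      fun y ↦ (g (he.toHomeomorph.symm ⟨y, image_subset_range _ _ y.2⟩)).1, by fun_prop, ?_⟩
    · rw [himage, compl_inter, ← preimage_compl, ← preimage_compl]
      exact (of_measurableSet n hem.measurableSet_range.compl).union
        ((hB.preimage hg.measurable).preimage hr)
    · have hsymm (c : ℕ → ℕ) : he.toHomeomorph.symm ⟨e c, c, rfl⟩ = c :=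
        he.toHomeomorph.symm_apply_apply c
      ext y
      constructor
      · rintro ⟨⟨_, c, hc, rfl⟩, rfl⟩
        exact ⟨g c, hc, by simp only [hsymm]⟩
      · rintro ⟨q, hq, rfl⟩
        obtain ⟨c, rfl⟩ := hgs q
        exact ⟨⟨e c, c, hq, rfl⟩, by simp only [hsymm]⟩
  induction n generalizing A with
  | zero =>
    refine step (fun B hB ↦ ?_) hA
    have hB' : MeasurableSet B := MeasurableSet.of_compl hB
    rwa [BorelSpace.measurable_eq (α := Y)] at hB'
  | succ n ih => exact step (fun B hB ↦ mem_projectiveClass_even.2 (ih hB)) hA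

end projectiveClass

/-! ### Complexity of the condition `μ_*(A) = 1`. -/

section radonProb

theorem innerMeasure_eq_measure {X : Type u} [MeasurableSpace X] (μ : Measure X) {A : Set X} (hA : MeasurableSet A) :
    innerMeasure μ A = μ A :=
  le_antisymm (iSup₂_le fun _ _ ↦ iSup_le measure_mono)
    (le_iSup₂_of_le A hA (le_iSup_of_le subset_rfl le_rfl))

variable {X : Type u} [TopologicalSpace X]

/-- The closed set with code `c`, relative to a sequence `U` of open sets. -/
def codedClosed (U : ℕ → Set X) (c : ℕ → ℕ) : Set X := {x | ∀ i, c i = 1 → x ∉ U i}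

variable {U : ℕ → Set X}

theorem isClosed_codedClosed (hU : ∀ i, IsOpen (U i)) (c : ℕ → ℕ) :
    IsClosed (codedClosed U c) := by
  simp only [codedClosed, ofPred_forall]
  exact isClosed_iInter fun i ↦ isClosed_iInter fun _ ↦ (hU i).isClosed_compl

theorem IsClosed.exists_eq_codedClosed (hU : IsTopologicalBasis (Set.range U)) {K : Set X}
    (hK : IsClosed K) : ∃ c, codedClosed U c = K := by
  classical
  refine ⟨fun i ↦ if Disjoint (U i) K then 1 else 0, ?_⟩
  ext x
  simp only [codedClosed, ite_eq_left_iff, zero_ne_one, imp_false, not_not, mem_ofPred_eq]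
  refine ⟨fun h ↦ ?_, fun hx i hi ↦ disjoint_right.1 hi hx⟩
  by_contra hx
  obtain ⟨_, ⟨i, rfl⟩, hxi, hi⟩ := hU.exists_subset_of_mem_open hx hK.isOpen_compl
  exact h i (disjoint_left.2 hi) hxi

theorem exists_seq_isTopologicalBasis (X : Type u) [TopologicalSpace X]
    [SecondCountableTopology X] : ∃ U : ℕ → Set X, IsTopologicalBasis (Set.range U) := by
  obtain ⟨b, hbc, -, hb⟩ := exists_countable_basis X
  -- Adding `∅` keeps the family nonempty, so a sequence enumerates it even when `X` is empty.
  obtain ⟨U, hU⟩ := (hbc.insert ∅).exists_eq_range (insert_nonempty _ _)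
  exact ⟨U, hU ▸ hb.insert_empty⟩

variable [MeasurableSpace X] [BorelSpace X]

theorem measurableSet_codedClosed (hU : ∀ i, IsOpen (U i)) :
    MeasurableSet {p : (ℕ → ℕ) × X | p.2 ∈ codedClosed U p.1} := by
  have h : {p : (ℕ → ℕ) × X | p.2 ∈ codedClosed U p.1} =
      ⋂ i, {p | p.1 i = 1 → p.2 ∉ U i} := by
    ext
    simp [codedClosed]
  rw [h]
  refine .iInter fun i ↦ ?_
  have h1 : MeasurableSet {p : (ℕ → ℕ) × X | p.1 i = 1} :=
    measurableSet_eq_fun (by fun_prop) measurable_const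
  exact h1.imp (measurable_snd (hU i).measurableSet).compl

theorem lt_innerMeasure_iff [PseudoMetrizableSpace X] (μ : Measure X)
    [IsFiniteMeasure μ] {A : Set X} {r : ENNReal} :
    r < innerMeasure μ A ↔ ∃ K ⊆ A, IsClosed K ∧ r < μ K := by
  constructor
  · intro h
    simp only [innerMeasure, lt_iSup_iff] at h
    obtain ⟨B, hB, hBA, hr⟩ := h
    obtain ⟨K, hKB, hK, hrK⟩ := hB.exists_lt_isClosed_of_ne_top (measure_ne_top μ B) hr
    exact ⟨K, hKB.trans hBA, hK, hrK⟩
  · rintro ⟨K, hKA, hK, hr⟩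
    exact hr.trans_le (le_iSup₂_of_le K hK.measurableSet (le_iSup_of_le hKA le_rfl))

variable {P : Type v} [MeasurableSpace P] {ν : P → Measure X}

theorem IsSigma.innerMeasure_eq_one [PolishSpace X] (hν : Measurable ν)
    [∀ p, IsProbabilityMeasure (ν p)] {n : ℕ} {A : Set X} (hA : IsSigma n Aᶜ) :
    IsSigma (n + 1) {p | innerMeasure (ν p) A = 1} := by
  cases n with
  | zero =>
    have hA' : MeasurableSet A := MeasurableSet.of_compl hA
    simp only [innerMeasure_eq_measure _ hA']
    exact of_measurableSet _
      ((Measure.measurable_coe hA').comp hν (measurableSet_singleton 1))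
  | succ n =>
    obtain ⟨U, hUb⟩ := exists_seq_isTopologicalBasis X
    have hU (i : ℕ) : IsOpen (U i) := hUb.isOpen ⟨i, rfl⟩
    obtain ⟨u, -, hu1, hu⟩ := exists_seq_strictMono_tendsto' (zero_lt_one (α := ENNReal))
    have key : {p | innerMeasure (ν p) A = 1} = ⋂ k, Prod.fst '' {q : P × (ℕ → ℕ) |
        codedClosed U q.2 ⊆ A ∧ u k < ν q.1 (codedClosed U q.2)} := by
      ext p
      have hle : innerMeasure (ν p) A ≤ 1 := iSup₂_le fun _ _ ↦ iSup_le fun _ ↦ prob_le_one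
      have h1 : innerMeasure (ν p) A = 1 ↔ ∀ k, u k < innerMeasure (ν p) A :=
        ⟨fun h k ↦ h ▸ (hu1 k).2, fun h ↦ hle.antisymm (le_of_tendsto' hu fun k ↦ (h k).le)⟩
      simp only [mem_ofPred_eq, h1, lt_innerMeasure_iff, mem_iInter, mem_image, Prod.exists,
        exists_and_right, exists_eq_right]
      refine forall_congr' fun k ↦ ⟨?_, ?_⟩
      · rintro ⟨K, hKA, hK, h⟩
        obtain ⟨c, rfl⟩ := hK.exists_eq_codedClosed hUb
        exact ⟨c, hKA, h⟩
      · rintro ⟨c, hcA, h⟩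
        exact ⟨_, hcA, isClosed_codedClosed hU c, h⟩
    rw [key]
    refine iInter fun k ↦ ⟨_, ?_, rfl⟩
    have hsub : IsSigma (n + 1) {c | ¬ codedClosed U c ⊆ A} := by
      convert ((of_measurableSet (n + 1) (measurableSet_codedClosed hU)).inter
        (hA.preimage measurable_snd)).image_fst using 1
      ext c
      simp [not_subset]
    -- Viewing `ν` as a kernel gives joint measurability in the point and the code.
    let κ : ProbabilityTheory.Kernel P X := ⟨ν, hν⟩
    have : ProbabilityTheory.IsMarkovKernel κ := ⟨inferInstance⟩
    have hmeas : Measurable fun q : P × (ℕ → ℕ) ↦ ν q.1 (codedClosed U q.2) := by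
      have := ProbabilityTheory.Kernel.measurable_kernel_prodMk_left
        (κ := κ.comap (Prod.fst : P × (ℕ → ℕ) → P) measurable_fst)
        (t := {p : (P × (ℕ → ℕ)) × X | p.2 ∈ codedClosed U p.1.2})
        ((measurable_snd.comp measurable_fst).prodMk measurable_snd (measurableSet_codedClosed hU))
      exact this
    convert (hsub.preimage (measurable_snd (α := P))).union
      (of_measurableSet (n + 1) (measurableSet_lt measurable_const hmeas).compl) using 1
    ext q
    simp only [mem_compl_iff, mem_ofPred_eq, mem_union, mem_preimage]
    tauto

/-- By the portmanteau theorem, `μ ↦ μ U` is lower semicontinuous for open `U`, and open sets form a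
generating π-system. -/
theorem measurable_toMeasure_of_borelSpace [PseudoMetrizableSpace X]
    [SecondCountableTopology X] :
    @Measurable (ProbabilityMeasure X) (Measure X) (borel _) _ (fun μ ↦ (μ : Measure X)) := by
  let : MeasurableSpace (ProbabilityMeasure X) := borel _
  have : BorelSpace (ProbabilityMeasure X) := ⟨rfl⟩
  refine Measurable.measure_of_isPiSystem_of_isProbabilityMeasure
    (BorelSpace.measurable_eq (α := X)) isPiSystem_isOpen fun U hU ↦ ?_
  refine LowerSemicontinuous.measurable fun μ ↦ lowerSemicontinuousAt_iff_le_liminf.2 ?_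
  exact ProbabilityMeasure.le_liminf_measure_open_of_tendsto tendsto_id hU

end radonProb

theorem theorem2p32 {X : Type*} [TopologicalSpace X] [CompactSpace X]
    [TopologicalSpace.MetrizableSpace X] [MeasurableSpace X] [BorelSpace X] :
    (∀ A : Set X, IsProjective A → IsProjective (radonProb A)) ∧
    (∀ (n : ℕ) (A : Set X), A ∈ projectiveClass X (2 * n) →
      radonProb A ∈ projectiveClass (ProbabilityMeasure X) (2 * n + 1)) := by
  let : MeasurableSpace (ProbabilityMeasure X) := borel _
  have : BorelSpace (ProbabilityMeasure X) := ⟨rfl⟩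
  let := TopologicalSpace.metrizableSpaceMetric X
  -- Compact metric spaces are Polish, so the previous results apply to `X` and `P(X)`.
  let := TopologicalSpace.metrizableSpaceMetric (ProbabilityMeasure X)
  have key {n : ℕ} {A : Set X} (hA : IsSigma n Aᶜ) :
      radonProb A ∈ projectiveClass (ProbabilityMeasure X) (2 * n + 1) :=
    (hA.innerMeasure_eq_one measurable_toMeasure_of_borelSpace).mem_projectiveClass
  refine ⟨fun A hA ↦ ?_, fun n A hA ↦ key (isSigma_compl_of_mem_projectiveClass hA)⟩
  obtain ⟨n, -, hn⟩ := hA.exists_isSigma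
  exact .of_mem_projectiveClass (key hn)
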